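/- Let $\kappa$ be a regular uncountable cardinal. Let $NS_\kappa$ denote the nonstationary ideal over $\kappa$, i.e. the collection of all subsets of $\kappa$ that are disjoint from some closed unbounded subset of $\kappa$. For a regular (infinite) cardinal $\theta<\kappa$ let $S^\theta_\kappa=\{\alpha<\kappa : \operatorname{cf}\alpha=\theta\}$ and let $NS^\theta_\kappa=\{A\subseteq\kappa : A\cap S^\theta_\kappa\in NS_\kappa\}$. An ideal $I$ over $\kappa$ is called $\lambda$-saturated if there is no sequence $\langle A_\alpha : \alpha<\lambda\rangle$ of subsets of $\kappa$ such that $A_\alpha\notin I$ for every $\alpha<\lambda$ and $A_\alpha\cap A_\beta\in I$ whenever $\alpha\neq\beta$. **Theorem.** 1. If $\kappa>\aleph_1$, then $NS_\kappa$ is not $\kappa^+$-saturated. 2. If $\theta$ is a regular cardinal with $\theta^+<\kappa$, then $NS^\theta_\kappa$ is not $\kappa^+$-saturated. Here $\kappa$ is an arbitrary regular uncountable cardinal, successor or limit. -/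

import Mathlib

open Cardinal Ordinal Order Set

universe u

/-- The nonstationary ideal `NS_κ` over `κ`, where `κ` is identified with the set
`Set.Iio κ.ord` of all ordinals below it: the collection of those subsets of `κ` that are
disjoint from some closed unbounded subset of `κ`. -/
def NS (κ : Cardinal.{u}) : Set (Set (Set.Iio κ.ord)) :=
  {A | ¬ IsStationary A}

/-- `NS_κ` restricted to `S`: the collection of all subsets of `κ` having a nonstationary
intersection with `S`. -/
def NSRestrict (κ : Cardinal.{u}) (S : Set (Set.Iio κ.ord)) : Set (Set (Set.Iio κ.ord)) :=
  {A | A ∩ S ∈ NS κ}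

/-- `S^θ_κ = {α < κ | cf α = θ}`. -/
def cofinalitySet (κ θ : Cardinal.{u}) : Set (Set.Iio κ.ord) :=
  {α | (α : Ordinal.{u}).cof = θ}

/-- `NS^θ_κ`, the restriction of `NS_κ` to `S^θ_κ`. -/
def NSCof (κ θ : Cardinal.{u}) : Set (Set (Set.Iio κ.ord)) :=
  NSRestrict κ (cofinalitySet κ θ)

/-- An ideal `I` over `κ` is `μ`-saturated if there is no sequence `⟨A_α | α < μ⟩` of subsets
of `κ` with `A_α ∉ I` for all `α`, and `A_α ∩ A_β ∈ I` whenever `α ≠ β`. -/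
def IsSaturatedIdeal {κ : Cardinal.{u}} (I : Set (Set (Set.Iio κ.ord))) (μ : Cardinal.{u}) :
    Prop :=
  ¬ ∃ A : Set.Iio μ.ord → Set (Set.Iio κ.ord),
      (∀ α, A α ∉ I) ∧ ∀ α β, α ≠ β → A α ∩ A β ∈ I

/-! ### Closed unbounded sets in a regular order -/

section Clubs

universe v

variable {α : Type v} [LinearOrder α]

/-! Suppose that the points of cofinality θ carry no antichain of length κ⁺ (`J` below). Then a
family of sets in which any κ members have an upper bound modulo nonstationary sets has an essential
maximum (`exists_essential_maximum`): otherwise the differences along an essentially increasing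
sequence form such an antichain. Two cases remain.

If κ = θ⁺⁺, put λ = θ⁺ and take κ⁺ eventually different functions a_ν on κ. Pigeonholing yields more
than κ stationary sets T_ν on which a_ν maps the ladder of δ into a fixed set of fewer than λ
values. Maximal diagonal unions, taken in λ disjoint blocks (`exists_disjoint_diagonal_covers`),
give one δ lying in λ many T_ν. Some single ladder point then carries λ distinct values, which is
too many.

If θ⁺⁺ < κ, essential maxima give club guessing at almost all points of cofinality θ, through points
of cofinality above θ⁺ (`exists_strong_club_guessing`). Take θ⁺ decreasing clubs, each consisting of
points at which the earlier ones are guessed. The least point of cofinality θ in their intersection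
has a smaller one below it, a contradiction. -/

theorem exists_forall_lt_of_mk_lt_cof {s : Set α} (h : #s < cof α) : ∃ b, ∀ x ∈ s, x < b :=
  not_isCofinal_iff.1 fun hs => (cof_le hs).not_gt h

theorem noMaxOrder_of_aleph0_lt_cof (h : ℵ₀ < cof α) : NoMaxOrder α := by
  refine ⟨fun a => ?_⟩
  obtain ⟨b, hb⟩ := exists_forall_lt_of_mk_lt_cof (s := {a})
    (by simpa using one_lt_aleph0.trans h)
  exact ⟨b, hb a rfl⟩

theorem mk_Iio_ord_toType_lt {c : Cardinal.{v}} (i : c.ord.ToType) : #(Iio i) < c := by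
  simpa using Cardinal.mk_Iio_lt i (by simp)

theorem isClub_Ioi [NoMaxOrder α] (a : α) : IsClub (Ioi a) := by
  refine ⟨(isUpperSet_Ioi a).dirSupClosed, fun b => ?_⟩
  obtain ⟨c, hc⟩ := exists_gt (max a b)
  exact ⟨c, (le_max_left _ _).trans_lt hc, ((le_max_right _ _).trans_lt hc).le⟩

/-- The points of `E` that are limits of points of `E`. -/
def derivedClub (E : Set α) : Set α :=
  {x | x ∈ E ∧ ∀ y < x, ∃ z ∈ E, y < z ∧ z < x}

theorem derivedClub_mono {E F : Set α} (h : E ⊆ F) : derivedClub E ⊆ derivedClub F :=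
  fun _ hx => ⟨h hx.1, fun y hy => let ⟨z, hz, h'⟩ := hx.2 y hy; ⟨z, h hz, h'⟩⟩

theorem not_isStationary_of_subset_compl {A C : Set α} (hC : IsClub C) (h : ∀ x ∈ C, x ∉ A) :
    ¬ IsStationary A :=
  not_isStationary_iff.2 ⟨C, hC, Set.disjoint_left.2 fun x hx hxC => h x hxC hx⟩

variable [WellFoundedLT α]

theorem exists_isLUB {s : Set α} (h : BddAbove s) : ∃ x, IsLUB s x :=
  ⟨wellFounded_lt.min _ h, WellFounded.min_mem _ _ _, fun _ hy => WellFounded.min_le _ hy⟩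

/-- A strictly increasing θ-sequence in C can be built because θ is below the cofinality; its
supremum lies in C. -/
theorem IsClub.exists_cof_eq {C : Set α} (hC : IsClub C) {θ : Cardinal.{v}} (hθ : θ.IsRegular)
    (h : θ < cof α) : ∃ x ∈ C, cof (Iio x) = θ := by
  have key : ∀ (i : θ.ord.ToType) (g : ∀ j, j < i → α), ∃ x ∈ C, ∀ j hj, g j hj < x := by
    intro i g
    obtain ⟨b, hb⟩ := exists_forall_lt_of_mk_lt_cof (s := range fun j : Iio i => g j j.2)
      (mk_range_le.trans_lt ((mk_Iio_ord_toType_lt i).trans h))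
    obtain ⟨x, hx, hbx⟩ := hC.isCofinal b
    exact ⟨x, hx, fun j hj => (hb _ ⟨⟨j, hj⟩, rfl⟩).trans_le hbx⟩
  choose G hG hG' using key
  let f : θ.ord.ToType → α := wellFounded_lt.fix G
  have hf : ∀ i, f i = G i (fun j _ => f j) := fun i => wellFounded_lt.fix_eq G i
  have hfC : ∀ i, f i ∈ C := fun i => hf i ▸ hG _ _
  have hmono : StrictMono f := fun j i hji => by
    rw [hf i]; exact hG' i (fun j _ => f j) j hji
  obtain ⟨b, hb⟩ := exists_forall_lt_of_mk_lt_cof (s := range f)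
    (mk_range_le.trans_lt (by simpa using h))
  obtain ⟨x, hx⟩ := exists_isLUB (s := range f) ⟨b, fun y hy => (hb y hy).le⟩
  have : Nonempty θ.ord.ToType := by
    rw [← mk_ne_zero_iff]; simpa using hθ.ne_zero
  have : NoMaxOrder θ.ord.ToType := Cardinal.noMaxOrder hθ.aleph0_le
  refine ⟨x, hC.isLUB_mem (range_subset_iff.2 hfC) (range_nonempty f) hx, ?_⟩
  have hlt : ∀ i, f i < x := fun i => by
    obtain ⟨j, hj⟩ := exists_gt i
    exact (hmono hj).trans_le (hx.1 ⟨j, rfl⟩)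
  have := cof_congr_of_strictMono (f := fun i => (⟨f i, hlt i⟩ : Iio x)) (fun _ _ h => hmono h) ?_
  · rw [← this, cof_toType, hθ.cof_ord]
  · rintro ⟨y, hy⟩
    obtain ⟨_, ⟨i, rfl⟩, hi⟩ := (lt_isLUB_iff hx).1 hy
    exact ⟨_, ⟨i, rfl⟩, hi.le⟩

variable [IsRegularCardinalOrder α]

theorem mk_Iio_lt_mk (x : α) : #(Iio x) < #α := by
  have h := typein_lt_type (α := α) (· < ·) x
  rw [← ord_cardinalMk, lt_ord] at h
  exact h

theorem mk_Iic_lt_mk (hα : ℵ₀ < cof α) (x : α) : #(Iic x) < #α := by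
  have := noMaxOrder_of_aleph0_lt_cof hα
  obtain ⟨y, hy⟩ := exists_gt x
  exact (mk_le_mk_of_subset fun z hz => lt_of_le_of_lt hz hy).trans_lt (mk_Iio_lt_mk y)

/-- Diagonal intersections of clubs are club. -/
theorem IsClub.diagonal (hα : ℵ₀ < cof α) {C : α → Set α} (hC : ∀ i, IsClub (C i)) :
    IsClub {x | ∀ i < x, x ∈ C i} := by
  have := noMaxOrder_of_aleph0_lt_cof hα
  refine ⟨?_, fun a => ?_⟩
  · rw [dirSupClosed_iff_of_linearOrder]
    intro s hs hs0 x hx i hi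
    obtain ⟨y, hy, hiy⟩ := (lt_isLUB_iff hx).1 hi
    refine (hC i).isLUB_mem (t := s ∩ Ici y) (fun z hz => hs hz.1 i (hiy.trans_le hz.2))
      ⟨y, hy, le_rfl⟩ ⟨fun z hz => hx.1 hz.1, fun b hb => hx.2 fun z hz => ?_⟩
    rcases le_total y z with h | h
    · exact hb ⟨hz, h⟩
    · exact h.trans (hb ⟨hy, le_rfl⟩)
  · have hD : ∀ x : α, IsClub (⋂ i : Iio x, C i) := fun x =>
      IsClub.iInter hα.ne' (by simpa using mk_Iio_lt_mk x) fun i => hC i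
    have key : ∀ x : α, ∃ y, x < y ∧ y ∈ ⋂ i : Iio x, C i := fun x => by
      obtain ⟨y, hy⟩ := exists_gt x
      obtain ⟨z, hz, hyz⟩ := (hD x).isCofinal y
      exact ⟨z, hy.trans_le hyz, hz⟩
    choose g hg hg' using key
    -- Closing off ω times: the limit of the iterates belongs to every C i with i below it.
    let f : ℕ → α := fun n => g^[n] a
    have hfs : ∀ n, f (n + 1) = g (f n) := fun n => Function.iterate_succ_apply' g n a
    have hmono : StrictMono f := strictMono_nat_of_lt_succ fun n => by rw [hfs]; exact hg _
    obtain ⟨b, hb⟩ := exists_forall_lt_of_mk_lt_cof (s := range f)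
      (by refine lt_of_le_of_lt ?_ hα; exact (countable_range f).le_aleph0)
    obtain ⟨x, hx⟩ := exists_isLUB (s := range f) ⟨b, fun y hy => (hb y hy).le⟩
    refine ⟨x, fun i hi => ?_, hx.1 ⟨0, rfl⟩⟩
    obtain ⟨_, ⟨n, rfl⟩, hn⟩ := (lt_isLUB_iff hx).1 hi
    refine (hC i).isLUB_mem (t := f '' Ioi n) ?_ ⟨_, n + 1, Nat.lt_succ_self n, rfl⟩
      ⟨?_, fun c hc => hx.2 ?_⟩
    · rintro _ ⟨m, hm, rfl⟩
      obtain ⟨k, rfl⟩ : ∃ k, m = k + 1 := ⟨m - 1, by have : n < m := hm; omega⟩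
      rw [hfs]
      have hnk : n ≤ k := Nat.lt_succ_iff.1 hm
      exact mem_iInter.1 (hg' (f k)) ⟨i, hn.trans_le (hmono.monotone hnk)⟩
    · rintro _ ⟨m, -, rfl⟩; exact hx.1 ⟨m, rfl⟩
    · rintro _ ⟨m, rfl⟩
      exact (hmono.monotone (by omega : m ≤ max m n + 1)).trans
        (hc ⟨max m n + 1, by simp only [mem_Ioi]; omega, rfl⟩)

theorem isClub_setOf_forall_map_lt (hα : ℵ₀ < cof α) (f : α → α) :
    IsClub {x | ∀ y < x, f y < x} :=
  have := noMaxOrder_of_aleph0_lt_cof hα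
  IsClub.diagonal hα fun y => isClub_Ioi (f y)

theorem IsClub.derivedClub (hα : ℵ₀ < cof α) {E : Set α} (hE : IsClub E) :
    IsClub (derivedClub E) := by
  have := noMaxOrder_of_aleph0_lt_cof hα
  have key : ∀ x : α, ∃ y, (y ∈ E ∧ x < y) ∧ ∀ z ∈ E, x < z → y ≤ z := fun x => by
    obtain ⟨y, hy⟩ := exists_gt x
    obtain ⟨z, hz, hyz⟩ := hE.isCofinal y
    have hne : {z | z ∈ E ∧ x < z}.Nonempty := ⟨z, hz, hy.trans_le hyz⟩
    exact ⟨wellFounded_lt.min _ hne, WellFounded.min_mem _ _ hne,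
      fun w hw hxw => WellFounded.min_le _ (show w ∈ {z | z ∈ E ∧ x < z} from ⟨hw, hxw⟩)⟩
  choose g hg hg' using key
  convert hE.inter hα.ne' (isClub_setOf_forall_map_lt hα g) using 1
  ext x
  refine and_congr_right fun _ => forall₂_congr fun y _ => ?_
  constructor
  · rintro ⟨z, hz, hyz, hzx⟩
    exact (hg' y z hz hyz).trans_lt hzx
  · exact fun h => ⟨g y, (hg y).1, (hg y).2, h⟩

end Clubs

/-! ### Consequences of saturation -/

section Saturation

universe v

theorem exists_surjective_of_mk_le {A B : Type v} [Nonempty B] (h : #B ≤ #A) :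
    ∃ f : A → B, Function.Surjective f :=
  let ⟨f⟩ := h
  ⟨Function.invFun f, Function.invFun_surjective f.injective⟩

theorem mk_iUnion_le_of_le {ι A : Type v} {s : ι → Set A} {c : Cardinal.{v}} (hc : ℵ₀ ≤ c)
    (hι : #ι ≤ c) (hs : ∀ i, #(s i) ≤ c) : #(⋃ i, s i) ≤ c :=
  (mk_iUnion_le s).trans <| (mul_le_mul' hι (ciSup_le' hs)).trans (mul_eq_self hc).le

variable {α : Type v} [LinearOrder α]

variable (α) in
/-- A ladder system: a choice of a cofinal subset of minimal size below every point. -/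
theorem exists_ladder : ∃ e : α → Set α, (∀ x, ∀ y ∈ e x, y < x) ∧
    (∀ x, ∀ y < x, ∃ z ∈ e x, y ≤ z) ∧ ∀ x, #(e x) = cof (Iio x) := by
  choose s hs hs' using fun x : α => exists_cof_eq (Iio x)
  refine ⟨fun x => Subtype.val '' s x, ?_, fun x y hy => ?_, fun x => ?_⟩
  · rintro x _ ⟨y, -, rfl⟩; exact y.2
  · obtain ⟨z, hz, hyz⟩ := hs x ⟨y, hy⟩
    exact ⟨z, ⟨z, hz, rfl⟩, hyz⟩
  · rw [mk_image_eq Subtype.val_injective, hs']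

/-- Any `α` many eventually different functions are disjoint beyond suitable thresholds. -/
theorem exists_thresholds [WellFoundedLT α] [IsRegularCardinalOrder α] (hα : ℵ₀ < cof α)
    {J : Type v} {a : J → α → α}
    (ha : ∀ μ ν, μ ≠ ν → ∃ b, ∀ β, b < β → a μ β ≠ a ν β) {Y : Set J} (hY : #Y ≤ #α) :
    ∃ g : J → α, ∀ μ ∈ Y, ∀ ν ∈ Y, μ ≠ ν → ∀ β, g μ ≤ β → g ν ≤ β → a μ β ≠ a ν β := by
  have ha' : ∀ μ ν, ∃ b, μ ≠ ν → ∀ β, b < β → a μ β ≠ a ν β := fun μ ν => by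
    by_cases h : μ = ν
    · have : Nonempty α := cof_ne_zero_iff.1 (aleph0_pos.trans hα).ne'
      exact ⟨Classical.arbitrary α, fun h' => (h' h).elim⟩
    · obtain ⟨b, hb⟩ := ha μ ν h
      exact ⟨b, fun _ => hb⟩
  choose b hb using ha'
  obtain ⟨p⟩ := hY
  have key : ∀ μ : J, ∃ c, ∀ (h : μ ∈ Y) (ν : Y), p ν ≤ p ⟨μ, h⟩ → b μ ν < c ∧ b ν μ < c := by
    intro μ
    by_cases h : μ ∈ Y
    · have hs : #{ν : Y | p ν ≤ p ⟨μ, h⟩} < cof α := by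
        rw [cof_eq_cardinalMk]
        refine lt_of_le_of_lt ?_ (mk_Iic_lt_mk hα (p ⟨μ, h⟩))
        exact mk_le_of_injective (f := fun ν : {ν : Y | p ν ≤ p ⟨μ, h⟩} =>
          (⟨p ν, ν.2⟩ : Iic (p ⟨μ, h⟩))) fun x y hxy =>
            Subtype.ext (p.injective (Subtype.ext_iff.1 hxy))
      obtain ⟨c₁, hc₁⟩ := exists_forall_lt_of_mk_lt_cof
        (s := range fun ν : {ν : Y | p ν ≤ p ⟨μ, h⟩} => b μ ν) (mk_range_le.trans_lt hs)
      obtain ⟨c₂, hc₂⟩ := exists_forall_lt_of_mk_lt_cof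
        (s := range fun ν : {ν : Y | p ν ≤ p ⟨μ, h⟩} => b ν μ) (mk_range_le.trans_lt hs)
      exact ⟨max c₁ c₂, fun _ ν hν => ⟨(hc₁ _ ⟨⟨ν, hν⟩, rfl⟩).trans_le (le_max_left _ _),
        (hc₂ _ ⟨⟨ν, hν⟩, rfl⟩).trans_le (le_max_right _ _)⟩⟩
    · have : Nonempty α := cof_ne_zero_iff.1 (aleph0_pos.trans hα).ne'
      exact ⟨Classical.arbitrary α, fun h' => (h h').elim⟩
  -- The threshold of μ handles only the ν enumerated no later than μ; of two members, the later one
  -- takes care of the pair.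
  choose g hg using key
  refine ⟨g, fun μ hμ ν hν hne β hβ hβ' => ?_⟩
  rcases le_total (p ⟨ν, hν⟩) (p ⟨μ, hμ⟩) with h | h
  · exact hb μ ν hne β ((hg μ hμ ⟨ν, hν⟩ h).1.trans_le hβ)
  · exact hb μ ν hne β ((hg ν hν ⟨μ, hμ⟩ h).2.trans_le hβ')

variable {J : Type v} [LinearOrder J] [WellFoundedLT J]

/-- If there is no `J`-indexed antichain modulo the nonstationary subsets of `S`, then a family of
sets in which any `α` many members have an essential upper bound has an essential maximum. -/
theorem exists_essential_maximum [Nonempty α] {S : Set α} (hJ : ∀ j : J, #(Iio j) ≤ #α)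
    (hsat : ¬ ∃ A : J → Set α, (∀ i, IsStationary (A i ∩ S)) ∧
      ∀ i j, i ≠ j → ¬ IsStationary (A i ∩ A j ∩ S))
    {F : Type v} [Nonempty F] (B : F → Set α)
    (hB : ∀ g : α → F, ∃ E, ∀ i, ¬ IsStationary ((B (g i) \ B E) ∩ S)) :
    ∃ E, ∀ E', ¬ IsStationary ((B E' \ B E) ∩ S) := by
  by_contra! h
  choose next hnext using h
  have bound : ∀ (j : J) (g : ∀ k, k < j → F),
      ∃ E, ∀ k hk, ¬ IsStationary ((B (g k hk) \ B E) ∩ S) := fun j g => by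
    rcases isEmpty_or_nonempty (Iio j) with hj | hj
    · exact ⟨Classical.arbitrary F, fun k hk => (hj.false ⟨k, hk⟩).elim⟩
    · obtain ⟨f, hf⟩ := exists_surjective_of_mk_le (hJ j)
      obtain ⟨E, hE⟩ := hB fun i => g (f i) (f i).2
      refine ⟨E, fun k hk => ?_⟩
      obtain ⟨i, hi⟩ := hf ⟨k, hk⟩
      have := hE i
      rwa [show g (f i) (f i).2 = g k hk by simp only [hi]] at this
  choose bd hbd using bound
  let f : J → F := wellFounded_lt.fix fun j g => next (bd j g)
  have hf : ∀ j, f j = next (bd j fun k _ => f k) := fun j => wellFounded_lt.fix_eq _ j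
  have key : ∀ k j, k < j → ¬ IsStationary ((B (f k) \ B (bd k fun l _ => f l)) ∩
      (B (f j) \ B (bd j fun l _ => f l)) ∩ S) := fun k j hkj hst =>
    hbd j (fun l _ => f l) k hkj (hst.mono fun x hx => ⟨⟨hx.1.1.1, hx.1.2.2⟩, hx.2⟩)
  -- A later difference omits the bound of all earlier sets, so it meets an earlier difference in a
  -- nonstationary set.
  refine hsat ⟨fun j => B (f j) \ B (bd j fun k _ => f k), fun j => ?_, fun i j hij => ?_⟩
  · have := hnext (bd j fun k _ => f k)
    rwa [← hf j] at this
  · rcases hij.lt_or_gt with h | h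
    · exact key i j h
    · rw [inter_comm (B (f i) \ _)]; exact key j i h

variable [WellFoundedLT α] [IsRegularCardinalOrder α]

/-- There are more than `α` many pairwise eventually different functions on `α`. -/
theorem exists_eventually_different (hJ : ∀ j : J, #(Iio j) ≤ #α) :
    ∃ a : J → α → α, ∀ μ ν, μ ≠ ν → ∃ b, ∀ β, b < β → a μ β ≠ a ν β := by
  have key : ∀ (j : J) (g : ∀ k, k < j → α → α),
      ∃ f : α → α, ∀ k hk, ∃ b, ∀ β, b < β → g k hk β ≠ f β := fun j g => by
    rcases isEmpty_or_nonempty (Iio j) with hj | hj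
    · exact ⟨id, fun k hk => (hj.false ⟨k, hk⟩).elim⟩
    · obtain ⟨h, hh⟩ := exists_surjective_of_mk_le (hJ j)
      -- At β only the functions with index below β have to be avoided, and these are too few to be
      -- cofinal.
      have : ∀ β : α, ∃ x, ∀ y ∈ range fun i : Iio β => g (h i) (h i).2 β, y < x := fun β =>
        exists_forall_lt_of_mk_lt_cof
          (mk_range_le.trans_lt ((mk_Iio_lt_mk β).trans_eq cof_eq_cardinalMk.symm))
      choose f hf using this
      refine ⟨f, fun k hk => ?_⟩
      obtain ⟨i, hi⟩ := hh ⟨k, hk⟩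
      refine ⟨i, fun β hβ => ?_⟩
      have := hf β _ ⟨⟨i, hβ⟩, rfl⟩
      simp only [hi] at this
      exact this.ne
  choose G hG using key
  let a : J → α → α := wellFounded_lt.fix G
  have ha : ∀ j, a j = G j fun k _ => a k := fun j => wellFounded_lt.fix_eq _ j
  have hlt : ∀ μ ν, μ < ν → ∃ b, ∀ β, b < β → a μ β ≠ a ν β := fun μ ν h => by
    rw [ha ν]; exact hG ν (fun k _ => a k) μ h
  refine ⟨a, fun μ ν h => ?_⟩
  rcases h.lt_or_gt with h | h
  · exact hlt μ ν h
  · obtain ⟨b, hb⟩ := hlt ν μ h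
    exact ⟨b, fun β hβ => (hb β hβ).symm⟩

/-- The diagonal union of `α` many members of a family essentially covers all members. -/
theorem exists_diagonal_cover (hα : ℵ₀ < cof α) {S : Set α} (hJ : ∀ j : J, #(Iio j) ≤ #α)
    (hsat : ¬ ∃ A : J → Set α, (∀ i, IsStationary (A i ∩ S)) ∧
      ∀ i j, i ≠ j → ¬ IsStationary (A i ∩ A j ∩ S))
    (T : J → Set α) {X : Set J} (hX : X.Nonempty) :
    ∃ z : α → J, (∀ j, z j ∈ X) ∧
      ∀ ν ∈ X, ¬ IsStationary ((T ν \ {δ | ∃ j < δ, δ ∈ T (z j)}) ∩ S) := by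
  have : Nonempty α := cof_ne_zero_iff.1 (aleph0_pos.trans hα).ne'
  have := noMaxOrder_of_aleph0_lt_cof hα
  have : Nonempty X := hX.to_subtype
  have hinf : ℵ₀ ≤ #α := hα.le.trans_eq cof_eq_cardinalMk
  obtain ⟨z, hz⟩ := exists_essential_maximum hJ hsat (F := α → X)
    (fun z => {δ | ∃ j < δ, δ ∈ T (z j)}) fun g => by
      obtain ⟨q, hq⟩ := exists_surjective_of_mk_le (A := α) (B := α × α)
        (by simp [mul_eq_self hinf])
      choose r hr using hq
      -- Coding pairs by single indices merges κ many diagonal unions into one; it works at points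
      -- closed under the coding `r (i, ·)`.
      refine ⟨fun k => g (q k).1 (q k).2, fun i =>
        not_isStationary_of_subset_compl (isClub_setOf_forall_map_lt hα fun y => r (i, y)) ?_⟩
      rintro δ hδ ⟨⟨⟨j, hj, hδj⟩, h⟩, -⟩
      exact h ⟨r (i, j), hδ j hj, by simpa [hr] using hδj⟩
  -- The diagonal union of the constant sequence ν is T ν apart from the bottom point.
  refine ⟨fun j => z j, fun j => (z j).2, fun ν hν hst => hz (fun _ => ⟨ν, hν⟩) ?_⟩
  let a : α := Classical.arbitrary α
  intro C hC
  obtain ⟨δ, hδ, hδC⟩ := hst (hC.inter hα.ne' (isClub_Ioi a))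
  exact ⟨δ, ⟨⟨⟨a, hδC.2, hδ.1.1⟩, hδ.1.2⟩, hδ.2⟩, hδC.1⟩

end Saturation

/-! ### The case κ = λ⁺ with λ > θ regular -/

section SuccessorOfRegular

universe v

variable {α : Type v} [LinearOrder α] [WellFoundedLT α] [IsRegularCardinalOrder α]
  {J : Type v} [LinearOrder J] [WellFoundedLT J]

/-- A transfinite sequence of disjoint blocks, each of which has a diagonal union covering all
later members of the family. -/
theorem exists_disjoint_diagonal_covers (hα : ℵ₀ < cof α) {S : Set α}
    (hJ : ∀ j : J, #(Iio j) ≤ #α)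
    (hsat : ¬ ∃ A : J → Set α, (∀ i, IsStationary (A i ∩ S)) ∧
      ∀ i j, i ≠ j → ¬ IsStationary (A i ∩ A j ∩ S))
    (T : J → Set α) {X : Set J} (hX : #α < #X)
    {L : Type v} [LinearOrder L] [WellFoundedLT L] (hL : #L ≤ #α) :
    ∃ z : L → α → J, (∀ i j, z i j ∈ X) ∧ (∀ i i', i ≠ i' → ∀ j j', z i j ≠ z i' j') ∧
      ∃ ν ∈ X, ∀ i, ¬ IsStationary ((T ν \ {δ | ∃ j < δ, δ ∈ T (z i j)}) ∩ S) := by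
  have hinf : ℵ₀ ≤ #α := hα.le.trans_eq cof_eq_cardinalMk
  have hdiff : ∀ {ι : Type v} (g : ι → α → J), #ι ≤ #α → ∃ ν ∈ X, ∀ i j, g i j ≠ ν := by
    intro ι g hι
    have hY : #(⋃ i, range (g i)) ≤ #α := mk_iUnion_le_of_le hinf hι fun i => mk_range_le
    by_contra! h
    refine hX.not_ge ((mk_le_mk_of_subset fun ν hν => ?_).trans hY)
    obtain ⟨i, j, hij⟩ := h ν hν
    exact mem_iUnion.2 ⟨i, j, hij⟩
  have key : ∀ (i : L) (g : ∀ k, k < i → α → J), ∃ z : α → J, (∀ j, z j ∈ X) ∧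
      (∀ k hk j j', g k hk j' ≠ z j) ∧ ∀ ν ∈ X, (∀ k hk j', g k hk j' ≠ ν) →
        ¬ IsStationary ((T ν \ {δ | ∃ j < δ, δ ∈ T (z j)}) ∩ S) := by
    intro i g
    obtain ⟨ν, hν, hν'⟩ := hdiff (fun k : Iio i => g k k.2) ((mk_set_le _).trans hL)
    obtain ⟨z, hz, hz'⟩ := exists_diagonal_cover hα hJ hsat T
      (X := {ν | ν ∈ X ∧ ∀ k hk j', g k hk j' ≠ ν}) ⟨ν, hν, fun k hk => hν' ⟨k, hk⟩⟩
    exact ⟨z, fun j => (hz j).1, fun k hk j j' => (hz j).2 k hk j', fun ν hν h => hz' ν ⟨hν, h⟩⟩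
  choose G hGX hGd hGc using key
  let z : L → α → J := wellFounded_lt.fix G
  have hz : ∀ i, z i = G i fun k _ => z k := fun i => wellFounded_lt.fix_eq _ i
  have hd : ∀ i i', i < i' → ∀ j j', z i j ≠ z i' j' := fun i i' h j j' => by
    rw [hz i']; exact hGd i' (fun k _ => z k) i h j' j
  obtain ⟨ν, hν, hν'⟩ := hdiff z hL
  refine ⟨z, fun i j => by rw [hz i]; exact hGX _ _ _, fun i i' h j j' => ?_, ν, hν, fun i => ?_⟩
  · rcases h.lt_or_gt with h | h
    · exact hd i i' h j j'
    · exact (hd i' i h j' j).symm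
  · rw [hz i]; exact hGc i (fun k _ => z k) ν hν fun k _ j' => hν' k j'

/-- If `#α = lam⁺` with `lam > θ` regular, then the points of cofinality `θ` carry an antichain of
stationary sets longer than `α`. -/
theorem exists_antichain_of_succ_eq (hα : ℵ₀ < cof α) (hJ : ∀ j : J, #(Iio j) ≤ #α)
    (hJ' : #α < #J) {θ lam : Cardinal.{v}} (hθ : θ.IsRegular) (hlam : lam.IsRegular)
    (h : θ < lam) (hsucc : succ lam = #α) :
    ∃ A : J → Set α, (∀ i, IsStationary (A i ∩ {δ | cof (Iio δ) = θ})) ∧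
      ∀ i j, i ≠ j → ¬ IsStationary (A i ∩ A j ∩ {δ | cof (Iio δ) = θ}) := by
  by_contra hsat
  have hinf : ℵ₀ ≤ #α := hα.le.trans_eq cof_eq_cardinalMk
  have hlamα : lam < #α := hsucc ▸ lt_succ lam
  have hlamcof : lam < cof α := hlamα.trans_eq cof_eq_cardinalMk.symm
  obtain ⟨a, ha⟩ := exists_eventually_different (α := α) hJ
  obtain ⟨e, he, he', hecard⟩ := exists_ladder α
  let L := lam.ord.ToType
  have hL : #L = lam := by simp [L]
  have hLne : Nonempty L := by rw [← mk_ne_zero_iff, hL]; exact hlam.ne_zero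
  have hLmax : NoMaxOrder L := Cardinal.noMaxOrder hlam.aleph0_le
  have hp : ∀ δ : α, ∃ p : α → L, InjOn p (Iio δ) := fun δ => by
    have : #(Iio δ) ≤ #L := by
      rw [hL, ← lt_succ_iff, hsucc]; exact mk_Iio_lt_mk δ
    obtain ⟨p⟩ := this
    refine ⟨fun x => if hx : x < δ then p ⟨x, hx⟩ else Classical.arbitrary L,
      fun x hx y hy hxy => ?_⟩
    have hx' : x < δ := hx
    have hy' : y < δ := hy
    simp only [hx', hy', dite_true] at hxy
    exact Subtype.ext_iff.1 (p.injective hxy)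
  choose p hp using hp
  have hcofL : ∀ s : Set L, #s < lam → ∃ b, ∀ x ∈ s, x < b := fun s hs =>
    exists_forall_lt_of_mk_lt_cof (by rwa [cof_toType, hlam.cof_ord])
  -- On T i ν the values of a ν along the ladder of δ have codes below i, hence come from fewer than
  -- λ candidates.
  let T : L → J → Set α := fun i ν => {δ | ∀ x ∈ e δ, a ν x < δ ∧ p δ (a ν x) < i}
  have hT : ∀ ν, ∃ i, IsStationary (T i ν ∩ {δ | cof (Iio δ) = θ}) := fun ν => by
    rw [← isStationary_iUnion_iff hα.ne' (by simpa [hL] using hlamcof)]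
    intro C hC
    obtain ⟨δ, ⟨hδC, hδ⟩, hδθ⟩ :=
      (hC.inter hα.ne' (isClub_setOf_forall_map_lt hα (a ν))).exists_cof_eq
      hθ (h.trans hlamcof)
    -- The ladder has only θ < λ points, so its codes are bounded in λ.
    obtain ⟨i, hi⟩ := hcofL ((fun x => p δ (a ν x)) '' e δ)
      (mk_image_le.trans_lt (by rwa [hecard, hδθ]))
    exact ⟨δ, mem_iUnion.2 ⟨i, fun x hx => ⟨hδ x (he δ x hx), hi _ ⟨x, hx, rfl⟩⟩, hδθ⟩, hδC⟩
  choose ι hι using hT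
  obtain ⟨i₀, hi₀⟩ : ∃ i, #α < #(ι ⁻¹' {i}) := by
    by_contra! hsmall
    refine hJ'.not_ge ?_
    have := mk_iUnion_le_of_le hinf (hL.trans_le hlamα.le) hsmall
    rwa [show (⋃ i, ι ⁻¹' {i}) = Set.univ from eq_univ_of_forall fun ν => mem_iUnion.2 ⟨ι ν, rfl⟩,
      mk_univ] at this
  obtain ⟨z, hzX, hzd, ν, hν, hcov⟩ := exists_disjoint_diagonal_covers hα hJ hsat (T i₀) hi₀
    (L := L) (hL.trans_le hlamα.le)
  obtain ⟨g, hg⟩ := exists_thresholds hα ha (Y := ⋃ i, range (z i))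
    (mk_iUnion_le_of_le hinf (hL.trans_le hlamα.le) fun i => mk_range_le)
  simp only [not_isStationary_iff] at hcov
  choose C hC hCdisj using hcov
  have hclub : IsClub (⋂ i, C i ∩ {δ | ∀ j < δ, g (z i j) < δ}) :=
    IsClub.iInter hα.ne' (by simpa [hL] using hlamcof) fun i =>
      (hC i).inter hα.ne' (isClub_setOf_forall_map_lt hα _)
  have hνst := hι ν
  rw [show ι ν = i₀ from hν] at hνst
  obtain ⟨δ, ⟨hδT, hδθ⟩, hδ⟩ := hνst hclub
  have hblock : ∀ i, ∃ j, δ ∈ T i₀ (z i j) ∧ g (z i j) < δ := fun i => by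
    have hδi := mem_iInter.1 hδ i
    by_contra! hno
    refine Set.disjoint_left.1 (hCdisj i) ⟨⟨hδT, ?_⟩, hδθ⟩ hδi.1
    rintro ⟨j, hj, hjT⟩
    exact (hδi.2 j hj).not_ge (hno j hjT)
  choose j hjT hjg using hblock
  choose x hxe hx using fun i => he' δ _ (hjg i)
  -- The λ blocks choose among θ ladder points, so λ of them share one point y beyond their
  -- thresholds.
  obtain ⟨y, hy⟩ := infinite_pigeonhole_card (fun i => (⟨x i, hxe i⟩ : e δ)) lam hL.ge
    hlam.aleph0_le
    (by rw [hecard, show cof (Iio δ) = θ from hδθ, hlam.cof_ord]; exact h)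
  refine hy.not_gt (lt_of_le_of_lt ?_ (mk_Iio_ord_toType_lt i₀))
  -- Distinct blocks supply distinct functions, which differ at y; their codes would inject λ many
  -- blocks into `Iio i₀`.
  refine mk_le_of_injective (f := fun i : ((fun i => (⟨x i, hxe i⟩ : e δ)) ⁻¹' {y}) =>
    (⟨p δ (a (z i (j i)) y), (hjT i y y.2).2⟩ : Iio i₀)) ?_
  rintro ⟨i, hi⟩ ⟨i', hi'⟩ heq
  by_contra hne
  have hne' : i ≠ i' := fun h => hne (Subtype.ext h)
  have hiy : x i = y := Subtype.ext_iff.1 hi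
  have hiy' : x i' = y := Subtype.ext_iff.1 hi'
  refine hg _ (mem_iUnion.2 ⟨i, j i, rfl⟩) _ (mem_iUnion.2 ⟨i', j i', rfl⟩) (hzd i i' hne' _ _) y
    (hiy ▸ hx i) (hiy' ▸ hx i') (hp δ (hjT i y y.2).1 (hjT i' y y.2).1 (Subtype.ext_iff.1 heq))

end SuccessorOfRegular

/-! ### Club guessing and the case θ⁺⁺ < κ -/

section Guessing

universe v

variable {α : Type v} [LinearOrder α]

/-- `A` is contained in `E` up to a proper initial segment of `δ`. -/
def AlmostSubset (δ : α) (A E : Set α) : Prop :=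
  ∃ ξ < δ, ∀ γ ∈ A, ξ < γ → γ ∈ E

theorem AlmostSubset.mono {δ : α} {A E E' : Set α} (h : AlmostSubset δ A E) (hE : E ⊆ E') :
    AlmostSubset δ A E' :=
  let ⟨ξ, hξ, h⟩ := h
  ⟨ξ, hξ, fun γ hγ hlt => hE (h γ hγ hlt)⟩

theorem isClub_preimage_Iio {D : Set α} (hD : IsClub D) {γ : α} (hγ : γ ∈ derivedClub D) :
    IsClub (Subtype.val ⁻¹' D : Set (Iio γ)) := by
  refine ⟨?_, fun x => ?_⟩
  · rw [dirSupClosed_iff_of_linearOrder]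
    intro s hs hs0 x hx
    refine hD.isLUB_mem (t := Subtype.val '' s) (by rintro _ ⟨y, hy, rfl⟩; exact hs hy)
      (hs0.image _) ⟨?_, fun b hb => ?_⟩
    · rintro _ ⟨y, hy, rfl⟩; exact hx.1 hy
    · by_contra! h
      exact h.not_ge (hx.2 (show (⟨b, h.trans x.2⟩ : Iio γ) ∈ upperBounds s from
        fun y hy => hb ⟨y, hy, rfl⟩))
  · obtain ⟨z, hz, hxz, hzγ⟩ := hγ.2 x x.2
    exact ⟨⟨z, hzγ⟩, hz, hxz.le⟩

theorem cof_Iio_coe {γ : α} (x : Iio γ) : cof (Iio x) = cof (Iio (x : α)) :=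
  cof_congr_of_strictMono (f := fun y : Iio x => (⟨y, y.2⟩ : Iio (x : α))) (fun _ _ h => h)
    fun y => ⟨y, ⟨⟨⟨y, lt_trans y.2 x.2⟩, y.2⟩, rfl⟩, le_rfl⟩

variable [WellFoundedLT α]

/-- The supremum of the elements of `E` that are at most `x`. -/
noncomputable def lastBelow (E : Set α) (x : α) : α :=
  wellFounded_lt.min (upperBounds (E ∩ Iic x)) ⟨x, fun _ h => h.2⟩

theorem isLUB_lastBelow (E : Set α) (x : α) : IsLUB (E ∩ Iic x) (lastBelow E x) :=
  ⟨WellFounded.min_mem _ _ _, fun _ hy => WellFounded.min_le _ hy⟩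

theorem lastBelow_le (E : Set α) (x : α) : lastBelow E x ≤ x :=
  (isLUB_lastBelow E x).2 fun _ h => h.2

theorem le_lastBelow {E : Set α} {x z : α} (hz : z ∈ E) (hzx : z ≤ x) : z ≤ lastBelow E x :=
  (isLUB_lastBelow E x).1 ⟨hz, hzx⟩

theorem lastBelow_mono {E F : Set α} (h : E ⊆ F) (x : α) : lastBelow E x ≤ lastBelow F x :=
  (isLUB_lastBelow E x).mono (isLUB_lastBelow F x) (inter_subset_inter_left _ h)

theorem IsClub.lastBelow_mem_or_isBot {E : Set α} (hE : IsClub E) (x : α) :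
    lastBelow E x ∈ E ∨ IsBot (lastBelow E x) := by
  rcases (E ∩ Iic x).eq_empty_or_nonempty with h | h
  · right
    have := isLUB_lastBelow E x
    rw [h] at this
    exact fun y => this.2 (by simp)
  · exact Or.inl (hE.isLUB_mem inter_subset_left h (isLUB_lastBelow E x))

/-- The values decrease with the clubs, so they stabilize by well-foundedness; unless it is the
bottom point, the stable value belongs to every E k. -/
theorem exists_lastBelow_eq {L : Type v} [LinearOrder L] [Nonempty L] {E : L → Set α}
    (hE : ∀ i, IsClub (E i)) (hanti : Antitone E) (x : α) :
    ∃ i, ∀ i', i ≤ i' → lastBelow (E i') x = lastBelow (⋂ k, E k) x := by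
  obtain ⟨_, ⟨i, rfl⟩, hi⟩ := wellFounded_lt.has_min (range fun i => lastBelow (E i) x)
    (range_nonempty _)
  have heq : ∀ i', i ≤ i' → lastBelow (E i') x = lastBelow (E i) x := fun i' h =>
    (lastBelow_mono (hanti h) x).antisymm (not_lt.1 (hi _ ⟨i', rfl⟩))
  refine ⟨i, fun i' h => le_antisymm ?_ (lastBelow_mono (iInter_subset _ _) x)⟩
  rw [heq i' h]
  by_cases hbot : IsBot (lastBelow (E i) x)
  · exact hbot _
  · refine le_lastBelow (mem_iInter.2 fun k => ?_) (lastBelow_le _ _)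
    have h' := heq (max i k) (le_max_left _ _)
    have := (hE (max i k)).lastBelow_mem_or_isBot x
    rw [h'] at this
    exact hanti (le_max_right _ _) (this.resolve_right hbot)

/-- The points reached in `n + 1` steps when walking down from `δ` along the ladders `e`, through
points of cofinality at most `σ`, rounding down to the set `E`. -/
noncomputable def walkLevel (e : α → Set α) (σ : Cardinal.{v}) (E : Set α) (δ : α) : ℕ → Set α
  | 0 => lastBelow E '' e δ
  | n + 1 => ⋃ β : {β // β ∈ walkLevel e σ E δ n ∧ cof (Iio β) ≤ σ}, lastBelow E '' e β

/-- All points reached when walking down from `δ` along the ladders `e`, through points of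
cofinality at most `σ`, rounding down to the set `E`. -/
noncomputable def walkSet (e : α → Set α) (σ : Cardinal.{v}) (E : Set α) (δ : α) : Set α :=
  ⋃ n : ULift.{v} ℕ, walkLevel e σ E δ n.down

theorem mem_walkSet {e : α → Set α} {σ : Cardinal.{v}} {E : Set α} {δ γ : α} :
    γ ∈ walkSet e σ E δ ↔ ∃ n, γ ∈ walkLevel e σ E δ n := by
  simp [walkSet]

theorem lastBelow_mem_walkSet {e : α → Set α} {σ : Cardinal.{v}} {E : Set α} {δ x : α}
    (hx : x ∈ e δ) : lastBelow E x ∈ walkSet e σ E δ :=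
  mem_walkSet.2 ⟨0, x, hx, rfl⟩

theorem lastBelow_mem_walkSet_of_mem {e : α → Set α} {σ : Cardinal.{v}} {E : Set α} {δ β x : α}
    (hβ : β ∈ walkSet e σ E δ) (hσ : cof (Iio β) ≤ σ) (hx : x ∈ e β) :
    lastBelow E x ∈ walkSet e σ E δ := by
  obtain ⟨n, hn⟩ := mem_walkSet.1 hβ
  exact mem_walkSet.2 ⟨n + 1, mem_iUnion.2 ⟨⟨β, hn, hσ⟩, x, hx, rfl⟩⟩

theorem exists_eq_lastBelow_of_mem_walkSet {e : α → Set α} {σ : Cardinal.{v}} {E : Set α}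
    {δ γ : α} (h : γ ∈ walkSet e σ E δ) : ∃ x, γ = lastBelow E x := by
  obtain ⟨n, hn⟩ := mem_walkSet.1 h
  cases n with
  | zero => obtain ⟨x, -, rfl⟩ := hn; exact ⟨x, rfl⟩
  | succ n => obtain ⟨β, x, -, rfl⟩ := mem_iUnion.1 hn; exact ⟨x, rfl⟩

theorem lt_of_mem_walkSet {e : α → Set α} (he : ∀ x, ∀ y ∈ e x, y < x) {σ : Cardinal.{v}}
    {E : Set α} {δ γ : α} (h : γ ∈ walkSet e σ E δ) : γ < δ := by
  obtain ⟨n, hn⟩ := mem_walkSet.1 h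
  induction n generalizing γ with
  | zero => obtain ⟨x, hx, rfl⟩ := hn; exact (lastBelow_le _ _).trans_lt (he _ _ hx)
  | succ n ih =>
    obtain ⟨β, x, hx, rfl⟩ := mem_iUnion.1 hn
    exact ((lastBelow_le _ _).trans_lt (he _ _ hx)).trans
      (ih (mem_walkSet.2 ⟨n, β.2.1⟩) β.2.1)

theorem mk_walkSet_le {e : α → Set α} (hecard : ∀ x, #(e x) = cof (Iio x)) {σ : Cardinal.{v}}
    (hσ : ℵ₀ ≤ σ) {E : Set α} {δ : α} (hδ : cof (Iio δ) ≤ σ) : #(walkSet e σ E δ) ≤ σ := by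
  refine mk_iUnion_le_of_le hσ (by simpa using hσ) fun n => ?_
  induction n.down with
  | zero => exact mk_image_le.trans ((hecard δ).trans_le hδ)
  | succ n ih =>
    exact mk_iUnion_le_of_le hσ ((mk_subtype_mono fun _ h => h.1).trans ih) fun β =>
      mk_image_le.trans ((hecard _).trans_le β.2.2)

/-- Along a decreasing sequence of clubs of length of cofinality above `σ`, walks stabilize. -/
theorem exists_walkSet_eq {L : Type v} [LinearOrder L] [Nonempty L] {E : L → Set α}
    (hE : ∀ i, IsClub (E i)) (hanti : Antitone E) {e : α → Set α}
    (hecard : ∀ x, #(e x) = cof (Iio x)) {σ : Cardinal.{v}} (hσ : ℵ₀ ≤ σ) (hL : σ < cof L)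
    {δ : α} (hδ : cof (Iio δ) ≤ σ) :
    ∃ i, walkSet e σ (E i) δ = walkSet e σ (⋂ k, E k) δ := by
  choose s hs using exists_lastBelow_eq hE hanti
  -- R collects every ladder point that the limit walk rounds down; there are at most σ of them, so
  -- their stabilization stages have a common bound.
  let R : Set α := e δ ∪ ⋃ β : {β // β ∈ walkSet e σ (⋂ k, E k) δ ∧ cof (Iio β) ≤ σ}, e β
  have hR : #R ≤ σ := (mk_union_le _ _).trans <| add_le_of_le hσ ((hecard δ).trans_le hδ) <|
    mk_iUnion_le_of_le hσ ((mk_subtype_mono fun _ h => h.1).trans (mk_walkSet_le hecard hσ hδ))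
      fun β => (hecard _).trans_le β.2.2
  obtain ⟨i, hi⟩ := exists_forall_lt_of_mk_lt_cof (s := s '' R) ((mk_image_le.trans hR).trans_lt hL)
  have hi' : ∀ x ∈ R, lastBelow (E i) x = lastBelow (⋂ k, E k) x := fun x hx =>
    hs x i (hi _ ⟨x, hx, rfl⟩).le
  refine ⟨i, iUnion_congr fun n => ?_⟩
  induction n.down with
  | zero => exact image_congr fun x hx => hi' x (Or.inl hx)
  | succ n ih =>
    simp only [walkLevel]
    rw [ih]
    refine iUnion_congr fun β => image_congr fun x hx => hi' x (Or.inr (mem_iUnion.2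
      ⟨⟨β, mem_walkSet.2 ⟨n, β.2.1⟩, β.2.2⟩, hx⟩))

theorem exists_antitone_clubs (hα : ℵ₀ < cof α) {L : Type v} [LinearOrder L] [WellFoundedLT L]
    (hL : #L < cof α) {op : Set α → Set α} (hop : ∀ E, IsClub E → IsClub (op E)) :
    ∃ F : L → Set α, (∀ i, IsClub (F i)) ∧ Antitone F ∧ ∀ i j, i < j → F j ⊆ op (F i) := by
  let F : L → Set α := wellFounded_lt.fix fun i g => ⋂ j : Iio i, op (g j j.2)
  have hF : ∀ i, F i = ⋂ j : Iio i, op (F j) := fun i => wellFounded_lt.fix_eq _ i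
  refine ⟨F, fun i => ?_, fun i j hij => ?_, fun i j hij => ?_⟩
  · induction i using WellFoundedLT.induction with
    | ind i ih =>
      rw [hF i]
      exact IsClub.iInter hα.ne' (by simpa using (mk_set_le _).trans_lt hL) fun j =>
        hop _ (ih j j.2)
  · rw [hF i, hF j]
    exact subset_iInter fun k => iInter_subset_of_subset ⟨k, lt_of_lt_of_le k.2 hij⟩ subset_rfl
  · rw [hF j]
    exact iInter_subset_of_subset ⟨i, hij⟩ subset_rfl

variable [IsRegularCardinalOrder α] {J : Type v} [LinearOrder J] [WellFoundedLT J]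

/-- Saturation provides a club that is essentially worst at being guessed by a given sequence. -/
theorem exists_worst_club (hα : ℵ₀ < cof α) {S : Set α} (hJ : ∀ j : J, #(Iio j) ≤ #α)
    (hsat : ¬ ∃ A : J → Set α, (∀ i, IsStationary (A i ∩ S)) ∧
      ∀ i j, i ≠ j → ¬ IsStationary (A i ∩ A j ∩ S)) (c : α → Set α) :
    ∃ E, IsClub E ∧ ∀ E', IsClub E' → ∃ C, IsClub C ∧
      ∀ δ ∈ C, δ ∈ S → AlmostSubset δ (c δ) E → AlmostSubset δ (c δ) E' := by
  have : Nonempty α := cof_ne_zero_iff.1 (aleph0_pos.trans hα).ne'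
  have := noMaxOrder_of_aleph0_lt_cof hα
  have : Nonempty {E : Set α // IsClub E} := ⟨⟨Set.univ, IsClub.univ⟩⟩
  obtain ⟨E, hE⟩ := exists_essential_maximum hJ hsat
    (fun E : {E : Set α // IsClub E} => {δ | ¬ AlmostSubset δ (c δ) E}) fun g => by
      -- Beyond i the diagonal intersection lies inside the i-th club, so for δ > i almost inclusion
      -- passes from the former to the latter.
      refine ⟨⟨_, IsClub.diagonal hα fun i => (g i).2⟩, fun i => ?_⟩
      refine not_isStationary_of_subset_compl (isClub_Ioi i) ?_
      rintro δ hδ ⟨⟨h, h'⟩, -⟩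
      obtain ⟨ξ, hξ, hsub⟩ := not_not.1 h'
      exact h ⟨max ξ i, max_lt hξ hδ, fun γ hγ hlt =>
        hsub γ hγ ((le_max_left _ _).trans_lt hlt) i ((le_max_right _ _).trans_lt hlt)⟩
  refine ⟨E, E.2, fun E' hE' => ?_⟩
  obtain ⟨C, hC, hdisj⟩ := not_isStationary_iff.1 (hE ⟨E', hE'⟩)
  refine ⟨C, hC, fun δ hδ hδS h => ?_⟩
  by_contra h'
  exact Set.disjoint_left.1 hdisj ⟨⟨h', not_not.2 h⟩, hδS⟩ hδ

/-- Under saturation there is a sequence that guesses every club at almost all points of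
cofinality `θ`, through points of cofinality above `σ`. -/
theorem exists_strong_club_guessing (hα : ℵ₀ < cof α) {θ σ : Cardinal.{v}} (hθ : θ.IsRegular)
    (hθσ : θ ≤ σ) (hσ : succ σ < cof α) (hJ : ∀ j : J, #(Iio j) ≤ #α)
    (hsat : ¬ ∃ A : J → Set α, (∀ i, IsStationary (A i ∩ {δ | cof (Iio δ) = θ})) ∧
      ∀ i j, i ≠ j → ¬ IsStationary (A i ∩ A j ∩ {δ | cof (Iio δ) = θ})) :
    ∃ c : α → Set α, (∀ δ, ∀ γ ∈ c δ, γ < δ) ∧ ∀ E, IsClub E → ∃ C : Set α, IsClub C ∧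
      ∀ δ ∈ C, cof (Iio δ) = θ → AlmostSubset δ (c δ) E ∧
        ∀ ξ < δ, ∃ γ ∈ c δ, ξ < γ ∧ σ < cof (Iio γ) := by
  have hσ0 : ℵ₀ ≤ σ := hθ.aleph0_le.trans hθσ
  obtain ⟨e, he, he', hecard⟩ := exists_ladder α
  choose H hH hH' using fun E : Set α => exists_worst_club hα hJ hsat (walkSet e σ E)
  let L := (succ σ).ord.ToType
  have hreg : (succ σ).IsRegular := isRegular_succ hσ0
  have hL : #L = succ σ := by simp [L]
  have : Nonempty L := by rw [← mk_ne_zero_iff, hL]; exact hreg.ne_zero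
  have : NoMaxOrder L := Cardinal.noMaxOrder hreg.aleph0_le
  have hLcof : σ < cof L := by rw [cof_toType, hreg.cof_ord]; exact lt_succ σ
  obtain ⟨F, hF, hanti, hFH⟩ := exists_antitone_clubs hα (L := L) (hL.trans_lt hσ) (op := H)
    fun E _ => hH E
  have hFinf : IsClub (⋂ i, F i) := IsClub.iInter hα.ne' (by simpa [hL] using hσ) hF
  have hidx : ∀ δ : α, ∃ i, cof (Iio δ) = θ → AlmostSubset δ (walkSet e σ (F i) δ) (H (F i)) := by
    intro δ
    by_cases hδ : Order.cof (Iio δ) = θ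
    · obtain ⟨i, hi⟩ := exists_walkSet_eq hF hanti hecard hσ0 hLcof (hδ.trans_le hθσ)
      obtain ⟨⟨ξ, hξ⟩⟩ : Nonempty (Iio δ) := Order.cof_ne_zero_iff.1 (hδ ▸ hθ.ne_zero)
      obtain ⟨k, hk⟩ := exists_gt i
      refine ⟨i, fun _ => ⟨ξ, hξ, fun γ hγ hξγ => hFH i k hk ?_⟩⟩
      rw [hi] at hγ
      obtain ⟨x, rfl⟩ := exists_eq_lastBelow_of_mem_walkSet hγ
      exact mem_iInter.1 ((hFinf.lastBelow_mem_or_isBot x).resolve_right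
        fun hbot => (hbot ξ).not_gt hξγ) k
    · exact ⟨Classical.arbitrary L, fun h => (hδ h).elim⟩
  choose idx hidx using hidx
  refine ⟨fun δ => walkSet e σ (F (idx δ)) δ, fun δ γ hγ => lt_of_mem_walkSet he hγ, fun E hE => ?_⟩
  -- Guessing also the limit points of the intersection lets walks be continued below the guessed
  -- points.
  have hE' := hE.inter hα.ne' (hFinf.derivedClub hα)
  choose C hC hCsub using fun i => hH' (F i) _ hE'
  refine ⟨(⋂ i, C i) ∩ derivedClub (⋂ i, F i),
    (IsClub.iInter hα.ne' (by simpa [hL] using hσ) hC).inter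
    hα.ne' (hFinf.derivedClub hα), fun δ hδ hδθ => ?_⟩
  have halm := hCsub (idx δ) δ (mem_iInter.1 hδ.1 _) hδθ (hidx δ hδθ)
  refine ⟨halm.mono inter_subset_left, fun ξ hξ => ?_⟩
  obtain ⟨ξ', hξ', hsub⟩ := halm
  have hder : ∀ x ∈ derivedClub (⋂ i, F i), x ∈ derivedClub (F (idx δ)) := fun x hx =>
    derivedClub_mono (iInter_subset _ _) hx
  have hreach : ∀ β m : α, β ∈ derivedClub (⋂ i, F i) → m < β →
      ∃ x ∈ e β, m < lastBelow (F (idx δ)) x := fun β m hβ hm => by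
    obtain ⟨z, hz, hmz, hzβ⟩ := (hder β hβ).2 m hm
    obtain ⟨x, hx, hzx⟩ := he' β z hzβ
    exact ⟨x, hx, hmz.trans_le (le_lastBelow hz hzx)⟩
  have hne : {γ | γ ∈ walkSet e σ (F (idx δ)) δ ∧ max ξ ξ' < γ}.Nonempty := by
    obtain ⟨x, hx, hlt⟩ := hreach δ (max ξ ξ') hδ.2 (max_lt hξ hξ')
    exact ⟨_, lastBelow_mem_walkSet hx, hlt⟩
  obtain ⟨β, ⟨hβ, hβlt⟩, hmin⟩ := wellFounded_lt.has_min _ hne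
  refine ⟨β, hβ, (le_max_left _ _).trans_lt hβlt, ?_⟩
  -- If cof β ≤ σ, the walk goes on below β; as β is a limit of the club, it reaches a smaller point
  -- still above the bound, against minimality.
  by_contra hcof
  obtain ⟨x, hx, hlt⟩ := hreach β _ (hsub β hβ ((le_max_right _ _).trans_lt hβlt)).2 hβlt
  exact hmin _ ⟨lastBelow_mem_walkSet_of_mem hβ (not_lt.1 hcof) hx, hlt⟩
    ((lastBelow_le _ _).trans_lt (he β x hx))

/-- If `α` is longer than `θ⁺⁺`, then the points of cofinality `θ` carry an antichain of
stationary sets longer than `α`. -/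
theorem exists_antichain_of_succ_succ_lt (hα : ℵ₀ < cof α) {θ : Cardinal.{v}} (hθ : θ.IsRegular)
    (hθα : succ (succ θ) < cof α) (hJ : ∀ j : J, #(Iio j) ≤ #α) :
    ∃ A : J → Set α, (∀ i, IsStationary (A i ∩ {δ | cof (Iio δ) = θ})) ∧
      ∀ i j, i ≠ j → ¬ IsStationary (A i ∩ A j ∩ {δ | cof (Iio δ) = θ}) := by
  by_contra hsat
  obtain ⟨c, hc, hguess⟩ := exists_strong_club_guessing hα hθ (le_succ θ) hθα hJ hsat
  obtain ⟨e, he, he', hecard⟩ := exists_ladder α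
  -- The new club retains only limit points of E at which the derived club of E is guessed; the
  -- value at a non-club is a dummy.
  have hop : ∀ E : Set α, ∃ C, IsClub E → IsClub C ∧ C ⊆ derivedClub E ∧
      ∀ δ ∈ C, cof (Iio δ) = θ → AlmostSubset δ (c δ) (derivedClub E) ∧
        ∀ ξ < δ, ∃ γ ∈ c δ, ξ < γ ∧ succ θ < cof (Iio γ) := fun E => by
    by_cases hE : IsClub E
    · obtain ⟨C, hC, h⟩ := hguess _ (hE.derivedClub hα)
      exact ⟨derivedClub E ∩ C, fun _ => ⟨(hE.derivedClub hα).inter hα.ne' hC,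
        inter_subset_left, fun δ hδ => h δ hδ.2⟩⟩
    · exact ⟨E, fun h => (hE h).elim⟩
  choose op hop using hop
  let K := (succ θ).ord.ToType
  have hreg : (succ θ).IsRegular := isRegular_succ hθ.aleph0_le
  have hK : #K = succ θ := by simp [K]
  have : Nonempty K := by rw [← mk_ne_zero_iff, hK]; exact hreg.ne_zero
  have : NoMaxOrder K := Cardinal.noMaxOrder hreg.aleph0_le
  have hKα : #K < cof α := hK.trans_lt ((lt_succ _).trans hθα)
  obtain ⟨D, hD, hanti, hDop⟩ := exists_antitone_clubs hα (L := K) hKα fun E hE => (hop E hE).1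
  have hDinf : IsClub (⋂ i, D i) := IsClub.iInter hα.ne' (by simpa using hKα) hD
  obtain ⟨δ₀, hδ₀, hδ₀θ⟩ := hDinf.exists_cof_eq hθ ((lt_succ θ).trans ((lt_succ _).trans hθα))
  obtain ⟨δ, ⟨hδ, hδθ⟩, hmin⟩ := wellFounded_lt.has_min {δ | δ ∈ ⋂ i, D i ∧ cof (Iio δ) = θ}
    ⟨δ₀, hδ₀, hδ₀θ⟩
  have hδop : ∀ i, δ ∈ op (D i) := fun i => by
    obtain ⟨k, hk⟩ := exists_gt i
    exact hDop i k hk (mem_iInter.1 hδ k)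
  have halm : ∀ i, ∃ ξ ∈ e δ, ∀ γ ∈ c δ, ξ < γ → γ ∈ derivedClub (D i) := fun i => by
    obtain ⟨ξ, hξ, h⟩ := ((hop _ (hD i)).2.2 δ (hδop i) hδθ).1
    obtain ⟨x, hx, hξx⟩ := he' δ ξ hξ
    exact ⟨x, hx, fun γ hγ hlt => h γ hγ (hξx.trans_lt hlt)⟩
  choose ξ hξe hξ using halm
  -- The θ⁺ thresholds lie in a ladder of size θ, so one threshold serves cofinally many i, and by
  -- antitonicity all i.
  obtain ⟨y, hy⟩ := infinite_pigeonhole_card (fun i => (⟨ξ i, hξe i⟩ : e δ)) (succ θ) hK.ge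
    hreg.aleph0_le (by rw [hecard, hδθ, hreg.cof_ord]; exact lt_succ θ)
  have hall : ∀ i, ∀ γ ∈ c δ, (y : α) < γ → γ ∈ derivedClub (D i) := fun i γ hγ hlt => by
    obtain ⟨k, hk, hik⟩ : ∃ k, ξ k = y ∧ i ≤ k := by
      by_contra! hno
      refine hy.not_gt (lt_of_le_of_lt (mk_le_mk_of_subset fun k hk => ?_)
        (mk_Iio_ord_toType_lt i))
      exact hno k (Subtype.ext_iff.1 hk)
    exact derivedClub_mono (hanti hik) (hξ k γ hγ (hk ▸ hlt))
  let i₀ : K := Classical.arbitrary K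
  obtain ⟨γ, hγ, hyγ, hγcof⟩ := ((hop _ (hD i₀)).2.2 δ (hδop i₀) hδθ).2 y (he δ y y.2)
  -- Since cof γ > θ⁺, the θ⁺ clubs still have club intersection inside γ; a point of cofinality θ
  -- there contradicts the minimality of δ.
  have hclub : IsClub (⋂ i, (Subtype.val ⁻¹' D i : Set (Iio γ))) :=
    IsClub.iInter (hreg.aleph0_le.trans_lt hγcof).ne' (by simpa [hK] using hγcof) fun i =>
      isClub_preimage_Iio (hD i) (hall i γ hγ hyγ)
  obtain ⟨x, hx, hxθ⟩ := hclub.exists_cof_eq hθ ((lt_succ θ).trans hγcof)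
  exact hmin x ⟨mem_iInter.2 fun i => mem_iInter.1 hx i, (cof_Iio_coe x).symm.trans hxθ⟩
    (lt_trans x.2 (hc δ γ hγ))

end Guessing

/-! ### Transfer to the ordinals below κ -/

theorem isRegularCardinalOrder_Iio_ord {κ : Cardinal.{u}} (hκ : κ.IsRegular) :
    IsRegularCardinalOrder (Iio κ.ord) where
  type_lt_le_ord_cof := by
    rw [Ordinal.cof_Iio, ← lift_cof, hκ.cof_ord, ← lift_ord]
    simp

theorem cof_Iio_Iio_ord {κ : Cardinal.{u}} (δ : Iio κ.ord) :
    Order.cof (Iio δ) = Cardinal.lift.{u + 1} (δ : Ordinal.{u}).cof := by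
  rw [cof_Iio_coe, Ordinal.cof_Iio, lift_cof]

/-- Below `κ`, the points of cofinality `θ` with `θ⁺ < κ` carry an antichain of `κ⁺` many
stationary sets. -/
theorem exists_antichain_cofinalitySet {κ θ : Cardinal.{u}} (hκ : κ.IsRegular) (hθ : θ.IsRegular)
    (h : succ θ < κ) :
    ∃ A : Iio (succ κ).ord → Set (Iio κ.ord), (∀ i, IsStationary (A i ∩ cofinalitySet κ θ)) ∧
      ∀ i j, i ≠ j → ¬ IsStationary (A i ∩ A j ∩ cofinalitySet κ θ) := by
  have := isRegularCardinalOrder_Iio_ord hκ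
  have hS : cofinalitySet κ θ = {δ | Order.cof (Iio δ) = Cardinal.lift.{u + 1} θ} := by
    ext δ
    rw [mem_ofPred_eq, cof_Iio_Iio_ord, Cardinal.lift_inj]
    rfl
  have hcof : Order.cof (Iio κ.ord) = Cardinal.lift.{u + 1} κ := by
    rw [Ordinal.cof_Iio, ← lift_cof, hκ.cof_ord]
  have hcard : #(Iio κ.ord) = Cardinal.lift.{u + 1} κ := cof_eq_cardinalMk.symm.trans hcof
  have hα : ℵ₀ < Order.cof (Iio κ.ord) := by
    rw [hcof, aleph0_lt_lift]
    exact (hθ.aleph0_le.trans_lt (lt_succ θ)).trans h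
  have := isRegularCardinalOrder_Iio_ord (isRegular_succ hκ.aleph0_le)
  have hcard' : #(Iio (succ κ).ord) = succ #(Iio κ.ord) := by
    rw [hcard, Cardinal.mk_Iio_ordinal, card_ord, Cardinal.lift_succ]
  have hJ : ∀ j : Iio (succ κ).ord, #(Iio j) ≤ #(Iio κ.ord) := fun j =>
    lt_succ_iff.1 (hcard' ▸ mk_Iio_lt_mk j)
  have hJ' : #(Iio κ.ord) < #(Iio (succ κ).ord) := hcard' ▸ lt_succ _
  rw [hS]
  rcases (succ_le_of_lt h).lt_or_eq with h' | h'
  · exact exists_antichain_of_succ_succ_lt hα hθ.lift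
      (by rw [hcof, ← Cardinal.lift_succ, ← Cardinal.lift_succ, Cardinal.lift_lt]; exact h') hJ
  · exact exists_antichain_of_succ_eq hα hJ hJ' hθ.lift (isRegular_succ hθ.aleph0_le).lift
      (Cardinal.lift_lt.2 (lt_succ θ)) (by rw [hcard, ← Cardinal.lift_succ, h'])

theorem mainTheorem2 (κ : Cardinal.{u}) (hκ : κ.IsRegular) :
    (Cardinal.aleph 1 < κ → ¬ IsSaturatedIdeal (NS κ) (Order.succ κ)) ∧
      (∀ θ : Cardinal.{u}, θ.IsRegular → Order.succ θ < κ →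
        ¬ IsSaturatedIdeal (NSCof κ θ) (Order.succ κ)) := by
  constructor
  · intro h
    obtain ⟨A, hA, hA'⟩ := exists_antichain_cofinalitySet hκ isRegular_aleph0
      (by rwa [succ_aleph0])
    -- Sets inside the points of cofinality ω turn smallness modulo the restricted ideal into
    -- smallness modulo the full one.
    refine not_not.2 ⟨fun i => A i ∩ cofinalitySet κ ℵ₀, fun i => not_not.2 (hA i),
      fun i j hij => ?_⟩
    rw [← inter_inter_distrib_right]
    exact hA' i j hij
  · intro θ hθ h
    obtain ⟨A, hA, hA'⟩ := exists_antichain_cofinalitySet hκ hθ h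
    exact not_not.2 ⟨A, fun i => not_not.2 (hA i), hA'⟩
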